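/- Let $F$ be a perfect field of characteristic $2$ with at least $5$ elements, $V$ a finite-dimensional vector space over $F$, and $\xi$ a nondegenerate symmetric bilinear form on $V$ such that $W=\{v\in V:\xi(v,v)=0\}$ is a vector subspace of codimension $1$. Let $\mathfrak P$ be the projective space over $V$ (points and lines are the subspaces of $V$ of dimension $1$ and $2$), let $\perp$ be the conjugacy on $\mathfrak P$ given by $\xi$, and let $\mathbf H$ be the hyperplane of $\mathfrak P$ determined by $W$. Assume that the pole $\mathbf b=W^\perp=\langle e_0\rangle$ of $\mathbf H$ does not lie on $\mathbf H$. A subspace $U$ of $V$ is called regular if $U\cap U^\perp=0$. Let $\mathfrak G_1$ be the incidence structure of all regular points and all regular lines, with inclusion as incidence, and let $\mathfrak B_1$ be obtained from $\mathfrak G_1$ by deleting the isolated points (those on no regular line) and the isolated lines (those through no regular point). An automorphism of $\mathfrak B_1$ is a permutation of its points together with a permutation of its lines preserving incidence in both directions. The map $w\mapsto\langle e_0+w\rangle$ is a bijection from $W$ onto the set of regular points, i.e. onto the point set of the affine space $\mathfrak A$ obtained from $\mathfrak P$ by deleting $\mathbf H$. It preserves and reflects collinearity, sends $0$ to $\mathbf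 b$, and sends $W\setminus\{0\}$ onto the point set of $\mathfrak B_1$. In these coordinates $$\operatorname{Aut}(\mathfrak B_1)=\{\varphi\in\Gamma L(W):\varphi\text{ preserves }\perp_{\mathbf H}\},$$ where $\Gamma L(W)$ is the group of all semilinear bijections of $W$ (with respect to arbitrary automorphisms of $F$), $\perp_{\mathbf H}$ is the restriction of $\perp$ to $\mathbf H$, and $\varphi$ preserves $\perp_{\mathbf H}$ if $\xi(\varphi(u),\varphi(v))=0\iff\xi(u,v)=0$ for all $u,v\in W$. That is, there is a group isomorphism $\Phi$ from $\operatorname{Aut}(\mathfrak B_1)$ onto the group on the right such that every automorphism $f$ maps the point $\langle e_0+w\rangle$ to $\langle e_0+\Phi(f)(w)\rangle$, for every $w\in W\setminus\{0\}$. -/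

import Mathlib

open Module

/-- A point-line geometry: points, lines and an incidence relation between them. -/
structure PointLineGeometry.{u} where
  Point : Type u
  Line : Type u
  Inc : Point → Line → Prop

namespace PointLineGeometry

/-- The geometry obtained by deleting the isolated points (those on no line) and the isolated
lines (those through no point). -/
def deleteIsolated (G : PointLineGeometry) : PointLineGeometry where
  Point := {p : G.Point // ∃ l, G.Inc p l}
  Line := {l : G.Line // ∃ p, G.Inc p l}
  Inc p l := G.Inc p.1 l.1

/-- The automorphism group: pairs of a permutation of the points and a permutation of the lines
which together preserve incidence in both directions. -/
def Aut (G : PointLineGeometry) : Subgroup (Equiv.Perm G.Point × Equiv.Perm G.Line) where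
  carrier := {f | ∀ p l, G.Inc (f.1 p) (f.2 l) ↔ G.Inc p l}
  one_mem' := fun _ _ => Iff.rfl
  mul_mem' := fun {f g} hf hg p l => (hf (g.1 p) (g.2 l)).trans (hg p l)
  inv_mem' := fun {f} hf p l => by
    simpa using (hf (f.1⁻¹ p) (f.2⁻¹ l)).symm

end PointLineGeometry

section Regular

variable {F V : Type*} [Field F] [AddCommGroup V] [Module F V]

/-- The radical `U ∩ U^⊥` of a subspace `U` with respect to the form `ξ`. -/
def radical (ξ : LinearMap.BilinForm F V) (U : Submodule F V) : Submodule F V :=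
  U ⊓ ξ.orthogonal U

/-- The regular subspaces of (vector) dimension `k`: those with trivial radical. Points and lines
of the projective space over `V` are the vector subspaces of dimension `1` and `2`. -/
def regularSubspaces (ξ : LinearMap.BilinForm F V) (k : ℕ) : Set (Submodule F V) :=
  {U | finrank F U = k ∧ radical ξ U = ⊥}

/-- The geometry of all regular points and all regular lines, with inclusion as incidence. -/
def regularGrassmannian (ξ : LinearMap.BilinForm F V) : PointLineGeometry where
  Point := regularSubspaces ξ 1
  Line := regularSubspaces ξ 2
  Inc p l := (p : Submodule F V) ≤ (l : Submodule F V)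

/-- The regular point-line geometry: the geometry of regular points and regular lines
without its isolated points and isolated lines. -/
def regularGeometry (ξ : LinearMap.BilinForm F V) : PointLineGeometry :=
  (regularGrassmannian ξ).deleteIsolated

/-- The one-dimensional subspace of `V` which a point of the regular geometry is. -/
def regularGeometry.pointSubspace {ξ : LinearMap.BilinForm F V}
    (p : (regularGeometry ξ).Point) : Submodule F V :=
  Subtype.val (p := fun U => U ∈ regularSubspaces ξ 1) (Subtype.val p)

/-- The projective point `⟨e₀ + w⟩`. If `e₀ ∉ W`, then `w ↦ ⟨e₀ + w⟩` presents the complement of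
the hyperplane determined by `W` as the affine space over `W` with `⟨e₀⟩` at the origin. -/
def affinePoint {W : Submodule F V} (e₀ : V) (w : W) : Submodule F V :=
  Submodule.span F {e₀ + (w : V)}

end Regular

section Semilinear

variable (F : Type*) [Field F]

/-- The group `ΓL(W)` of semilinear bijections of the vector space `W`. -/
def semilinearGroup (W : Type*) [AddCommGroup W] [Module F W] : Subgroup (Equiv.Perm W) where
  carrier := {φ | (∀ u v, φ (u + v) = φ u + φ v) ∧
    ∃ σ : F ≃+* F, ∀ (c : F) (u : W), φ (c • u) = σ c • φ u}
  one_mem' := ⟨fun _ _ => rfl, RingEquiv.refl F, fun _ _ => rfl⟩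
  mul_mem' := by
    rintro φ ψ ⟨hφ, σ, hσ⟩ ⟨hψ, τ, hτ⟩
    exact ⟨fun u v => by simp [hφ, hψ], τ.trans σ, fun c u => by simp [hσ, hτ]⟩
  inv_mem' := by
    rintro φ ⟨hφ, σ, hσ⟩
    refine ⟨fun u v => φ.injective (by simp [hφ]), σ.symm, fun c u => φ.injective (by simp [hσ])⟩

variable {F}

/-- The permutations of `W` which preserve the conjugacy `ξ₀ u v = 0` of vectors of `W`. -/
def conjugacyStabilizer {W : Type*} [AddCommGroup W] [Module F W]
    (ξ₀ : LinearMap.BilinForm F W) : Subgroup (Equiv.Perm W) where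
  carrier := {φ | ∀ u v, ξ₀ (φ u) (φ v) = 0 ↔ ξ₀ u v = 0}
  one_mem' := fun _ _ => Iff.rfl
  mul_mem' := fun {φ ψ} hφ hψ u v => (hφ (ψ u) (ψ v)).trans (hψ u v)
  inv_mem' := fun {φ} hφ u v => by
    simpa using (hφ (φ⁻¹ u) (φ⁻¹ v)).symm

end Semilinear

section Symplectic

variable {F W : Type*} [Field F] [AddCommGroup W] [Module F W]

/-- The permutation `g` maps every affine line `p + F d` with `B p d ≠ 0` onto a line of this
kind. -/
def MapsHyperbolicLines (B : LinearMap.BilinForm F W) (g : Equiv.Perm W) : Prop :=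
  ∀ p d, B p d ≠ 0 → ∃ p' d', B p' d' ≠ 0 ∧ ∀ w, (∃ t : F, g w = p' + t • d') ↔
    ∃ t : F, w = p + t • d

theorem exists_apply_ne_zero_of_three (hF : 5 ≤ ENat.card F) {B : LinearMap.BilinForm F W}
    (hB : ∀ u, (∀ v, B u v = 0) → u = 0) {x y z : W} (hx : x ≠ 0) (hy : y ≠ 0) (hz : z ≠ 0) :
    ∃ w, B x w ≠ 0 ∧ B y w ≠ 0 ∧ B z w ≠ 0 := by
  have key : ∀ i : Fin 3, ∃ w, B (![x, y, z] i) w ≠ 0 := by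
    intro i
    by_contra! h
    have := hB _ h
    fin_cases i <;> simp_all
  have h := Submodule.iUnion_ssubset_of_forall_ne_top_of_card_lt (K := F) Finset.univ
    (fun i : Fin 3 => LinearMap.ker (B (![x, y, z] i)))
    (fun i hi => by
      obtain ⟨w, hw⟩ := key i
      exact hw (LinearMap.mem_ker.1 (hi ▸ Submodule.mem_top)))
    (lt_of_lt_of_le (by rw [Finset.card_univ, Fintype.card_fin]; norm_num) hF)
  obtain ⟨w, -, hw⟩ := Set.exists_of_ssubset h
  simp only [Finset.mem_univ, Set.iUnion_true, Set.mem_iUnion, SetLike.mem_coe, LinearMap.mem_ker,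
    not_exists] at hw
  exact ⟨w, hw 0, hw 1, hw 2⟩

theorem mem_span_pair_of_forall_apply_eq_zero {B : LinearMap.BilinForm F W}
    (hB : ∀ u, (∀ v, B u v = 0) → u = 0) {u v x : W}
    (h : ∀ y, B u y = 0 → B v y = 0 → B x y = 0) : ∃ a b : F, x = a • u + b • v := by
  have hmem : B x ∈ Submodule.span F (Set.range ![B u, B v]) := by
    refine mem_span_of_iInf_ker_le_ker fun y hy => ?_
    rw [Submodule.mem_iInf] at hy
    exact h y (hy 0) (hy 1)
  rw [Matrix.range_cons_cons_empty, Submodule.mem_span_pair] at hmem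
  obtain ⟨a, b, hab⟩ := hmem
  refine ⟨a, b, sub_eq_zero.1 (hB _ fun y => ?_)⟩
  simp [← hab]

variable {B : LinearMap.BilinForm F W} {g : Equiv.Perm W}

theorem MapsHyperbolicLines.apply_ne_zero (halt : ∀ u, B u u = 0) (hg : MapsHyperbolicLines B g)
    {u v : W} (huv : B u v ≠ 0) : B (g u) (g v) ≠ 0 := by
  obtain ⟨p, d, hpd, h⟩ := hg u (v - u) (by simpa [halt])
  obtain ⟨s, hs⟩ := (h u).2 ⟨0, by simp⟩
  obtain ⟨t, ht⟩ := (h v).2 ⟨1, by simp⟩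
  have hst : s ≠ t := by
    rintro rfl
    have := g.injective (hs.trans ht.symm)
    exact huv (this ▸ halt u)
  have hdp : B d p = -B p d := (LinearMap.IsAlt.neg (B := B) halt p d).symm
  have : B (g u) (g v) = (t - s) * B p d := by
    rw [hs, ht]
    simp [halt, hdp]
    ring
  rw [this]
  exact mul_ne_zero (sub_ne_zero.2 hst.symm) hpd

theorem MapsHyperbolicLines.apply_eq_zero_iff (halt : ∀ u, B u u = 0)
    (hg : MapsHyperbolicLines B g) (hg' : MapsHyperbolicLines B g⁻¹) (u v : W) :
    B (g u) (g v) = 0 ↔ B u v = 0 := by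
  refine not_iff_not.1 ⟨fun h => ?_, hg.apply_ne_zero halt⟩
  simpa using hg'.apply_ne_zero halt h

theorem exists_apply_add_eq (hB : ∀ u, (∀ v, B u v = 0) → u = 0)
    (hperp : ∀ u v, B (g u) (g v) = 0 ↔ B u v = 0) (u v : W) :
    ∃ a b : F, g (u + v) = a • g u + b • g v := by
  refine mem_span_pair_of_forall_apply_eq_zero hB fun y => ?_
  obtain ⟨y, rfl⟩ := g.surjective y
  simp only [hperp, map_add, LinearMap.add_apply]
  intro h1 h2
  rw [h1, h2, add_zero]

theorem exists_eq_smul_of_forall_apply_eq_zero (hB : ∀ u, (∀ v, B u v = 0) → u = 0) {u x : W}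
    (h : ∀ y, B u y = 0 → B x y = 0) : ∃ a : F, x = a • u := by
  obtain ⟨a, b, hab⟩ := mem_span_pair_of_forall_apply_eq_zero hB (u := u) (v := u)
    fun y hy _ => h y hy
  exact ⟨a + b, by rw [hab, add_smul]⟩

theorem MapsHyperbolicLines.apply_add_left (halt : ∀ u, B u u = 0)
    (hg : MapsHyperbolicLines B g) (hperp : ∀ u v, B (g u) (g v) = 0 ↔ B u v = 0) {u v : W}
    (huv : B u v ≠ 0) : B (g (u + v)) (g v) = B (g u) (g v) := by
  obtain ⟨p, d, hpd, h⟩ := hg u v huv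
  obtain ⟨s, hs⟩ := (h u).2 ⟨0, by simp⟩
  obtain ⟨t, ht⟩ := (h (u + v)).2 ⟨1, by simp⟩
  have hd : B d (g v) = 0 := by
    by_contra hd
    set r : F := -(B p (g v) / B d (g v)) with hr
    obtain ⟨q, hq⟩ := (h (g.symm (p + r • d))).1 ⟨r, by simp⟩
    have h0 : B (p + r • d) (g v) = 0 := by
      simp [hr, hd]
    rw [← g.apply_symm_apply (p + r • d), hperp, hq] at h0
    apply huv
    simpa [halt] using h0
  rw [hs, ht]
  simp [hd]

theorem MapsHyperbolicLines.map_add_of_apply_ne_zero (halt : ∀ u, B u u = 0)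
    (hB : ∀ u, (∀ v, B u v = 0) → u = 0) (hg : MapsHyperbolicLines B g)
    (hperp : ∀ u v, B (g u) (g v) = 0 ↔ B u v = 0) {u v : W} (huv : B u v ≠ 0) :
    g (u + v) = g u + g v := by
  have hne : ∀ {u v : W}, B u v ≠ 0 → B v u ≠ 0 := fun {u v} h => by
    rwa [← LinearMap.IsAlt.neg (B := B) halt u v, neg_ne_zero]
  obtain ⟨a, b, hab⟩ := exists_apply_add_eq hB hperp u v
  have h1 := hg.apply_add_left halt hperp huv
  have h2 := hg.apply_add_left halt hperp (hne huv)
  rw [add_comm v u] at h2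
  rw [hab] at h1 h2
  have h3 : B (g u) (g v) ≠ 0 := fun h => huv ((hperp u v).1 h)
  simp only [map_add, map_smul, LinearMap.add_apply, LinearMap.smul_apply, halt, smul_eq_mul,
    mul_zero, add_zero, zero_add] at h1 h2
  rw [hab, mul_right_cancel₀ h3 (h1.trans (one_mul _).symm),
    mul_right_cancel₀ (hne h3) (h2.trans (one_mul _).symm), one_smul, one_smul]

theorem MapsHyperbolicLines.map_add [CharP F 2] (hF : 5 ≤ ENat.card F) (halt : ∀ u, B u u = 0)
    (hB : ∀ u, (∀ v, B u v = 0) → u = 0) (hg : MapsHyperbolicLines B g) (hg0 : g 0 = 0)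
    (hperp : ∀ u v, B (g u) (g v) = 0 ↔ B u v = 0) (u v : W) :
    g (u + v) = g u + g v := by
  have htwo : ∀ x : W, x + x = 0 := fun x => by
    rw [← two_smul F x, CharTwo.two_eq_zero, zero_smul]
  rcases eq_or_ne u 0 with rfl | hu
  · simp [hg0]
  rcases eq_or_ne v 0 with rfl | hv
  · simp [hg0]
  rcases eq_or_ne (u + v) 0 with huv | huv
  · have : u = v := by
      rw [← sub_eq_zero, sub_eq_add_neg, ← huv, neg_eq_of_add_eq_zero_left (htwo v)]
    rw [this, htwo, htwo, hg0]
  by_cases hB0 : B u v = 0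
  · obtain ⟨w, hw1, hw2, hw3⟩ := exists_apply_ne_zero_of_three hF hB hu hv huv
    have hw : B (u + w) (v + w) ≠ 0 := by
      have : B w v = B v w := by
        rw [← LinearMap.IsAlt.neg (B := B) halt v w, CharTwo.neg_eq]
      simpa [halt, hB0, this, add_comm] using hw3
    have h := hg.map_add_of_apply_ne_zero halt hB hperp hw
    rw [hg.map_add_of_apply_ne_zero halt hB hperp hw1,
      hg.map_add_of_apply_ne_zero halt hB hperp hw2, add_add_add_comm, htwo, add_zero] at h
    rw [h, add_add_add_comm, htwo, add_zero]
  · exact hg.map_add_of_apply_ne_zero halt hB hperp hB0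

/-- An additive permutation of a symplectic space which preserves
orthogonality is semilinear. -/
theorem mem_semilinearGroup_of_map_add (hF : 5 ≤ ENat.card F) (halt : ∀ u, B u u = 0)
    (hB : ∀ u, (∀ v, B u v = 0) → u = 0)
    (hperp : ∀ u v, B (g u) (g v) = 0 ↔ B u v = 0) (hadd : ∀ u v, g (u + v) = g u + g v) :
    g ∈ semilinearGroup F W := by
  refine ⟨hadd, ?_⟩
  rcases subsingleton_or_nontrivial W with hW | hW
  · exact ⟨RingEquiv.refl F, fun c u => Subsingleton.elim _ _⟩
  have hg0 : g 0 = 0 := by simpa using hadd 0 0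
  have hgne : ∀ {u : W}, u ≠ 0 → g u ≠ 0 := fun hu h => hu (g.injective (h.trans hg0.symm))
  have hex : ∀ (u : W) (c : F), ∃ a : F, g (c • u) = a • g u := by
    intro u c
    refine exists_eq_smul_of_forall_apply_eq_zero hB fun y => ?_
    obtain ⟨y, rfl⟩ := g.surjective y
    simp only [hperp, map_smul, LinearMap.smul_apply]
    intro h
    rw [h, smul_zero]
  choose s hs using hex
  have hconst : ∀ {u v : W}, B u v ≠ 0 → ∀ c, s u c = s v c := by
    intro u v huv c
    have h1 := hs (u + v) c
    rw [smul_add, hadd, hadd, hs, hs, smul_add] at h1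
    have h3 : B (g u) (g v) ≠ 0 := fun h => huv ((hperp u v).1 h)
    have h4 := congrArg (fun x => B x (g v)) h1
    have h5 := congrArg (fun x => B (g u) x) h1
    simp only [_root_.map_add, map_smul, LinearMap.add_apply, LinearMap.smul_apply, halt,
      smul_eq_mul, mul_zero, add_zero, zero_add] at h4 h5
    rw [mul_right_cancel₀ h3 h4, mul_right_cancel₀ h3 h5]
  obtain ⟨e, he⟩ := exists_ne (0 : W)
  have hse : ∀ {u : W}, u ≠ 0 → ∀ c, s u c = s e c := by
    intro u hu c
    obtain ⟨w, h1, h2, -⟩ := exists_apply_ne_zero_of_three hF hB hu he he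
    rw [hconst h1, hconst h2]
  have hs' : ∀ (c : F) (u : W), g (c • u) = s e c • g u := by
    intro c u
    rcases eq_or_ne u 0 with rfl | hu
    · simp [hg0]
    · rw [hs, hse hu]
  have hcancel : ∀ {a b : F}, a • g e = b • g e → a = b := fun h =>
    smul_left_injective F (hgne he) h
  have hinj : Function.Injective (s e) := by
    intro a b hab
    apply smul_left_injective F he
    apply g.injective
    simp only [hs', hab]
  have hsurj : Function.Surjective (s e) := by
    intro a
    obtain ⟨x, hx⟩ := g.surjective (a • g e)
    obtain ⟨c, hc⟩ : ∃ c : F, x = c • e := by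
      refine exists_eq_smul_of_forall_apply_eq_zero hB fun y hy => ?_
      rw [← hperp, hx, map_smul, LinearMap.smul_apply, (hperp e y).2 hy, smul_zero]
    refine ⟨c, hcancel ?_⟩
    rw [← hs', ← hc, hx]
  refine ⟨{ Equiv.ofBijective (s e) ⟨hinj, hsurj⟩ with
    map_mul' := fun a b => hcancel ?_
    map_add' := fun a b => hcancel ?_ }, hs'⟩
  · change s e (a * b) • g e = (s e a * s e b) • g e
    rw [← hs', mul_smul, mul_smul, hs', hs']
  · change s e (a + b) • g e = (s e a + s e b) • g e
    rw [← hs', add_smul, add_smul, hadd, hs', hs']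

theorem mapsHyperbolicLines_of_mem_semilinearGroup (hg : g ∈ semilinearGroup F W)
    (hperp : ∀ u v, B (g u) (g v) = 0 ↔ B u v = 0) : MapsHyperbolicLines B g := by
  obtain ⟨hadd, σ, hσ⟩ := hg
  refine fun p d hpd => ⟨g p, g d, fun h => hpd ((hperp p d).1 h), fun w => ?_⟩
  constructor
  · rintro ⟨t, ht⟩
    exact ⟨σ.symm t, g.injective (by rw [ht, hadd, hσ, σ.apply_symm_apply])⟩
  · rintro ⟨t, rfl⟩
    exact ⟨σ t, by rw [hadd, hσ]⟩

theorem mapsHyperbolicLines_iff [CharP F 2] (hF : 5 ≤ ENat.card F) (halt : ∀ u, B u u = 0)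
    (hB : ∀ u, (∀ v, B u v = 0) → u = 0) :
    g 0 = 0 ∧ MapsHyperbolicLines B g ∧ MapsHyperbolicLines B g⁻¹ ↔
      g ∈ semilinearGroup F W ⊓ conjugacyStabilizer B := by
  constructor
  · rintro ⟨hg0, hg, hg'⟩
    have hperp := hg.apply_eq_zero_iff halt hg'
    exact ⟨mem_semilinearGroup_of_map_add hF halt hB hperp
      (hg.map_add hF halt hB hg0 hperp), hperp⟩
  · rintro ⟨h1, h2⟩
    exact ⟨by simpa using h1.1 0 0, mapsHyperbolicLines_of_mem_semilinearGroup h1 h2,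
      mapsHyperbolicLines_of_mem_semilinearGroup (g := g⁻¹)
        (Subgroup.inv_mem _ h1) (Subgroup.inv_mem (conjugacyStabilizer B) h2)⟩

end Symplectic

namespace PointLineGeometry

variable {G : PointLineGeometry}

/-- If a line is determined by its points, a permutation of the points which maps, in both
directions, lines onto lines extends to an automorphism. -/
theorem exists_mem_aut_of_maps_lines
    (hext : ∀ l l' : G.Line, (∀ p, G.Inc p l ↔ G.Inc p l') → l = l') (g : Equiv.Perm G.Point)
    (hg : ∀ l, ∃ l', ∀ p, G.Inc (g p) l' ↔ G.Inc p l)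
    (hg' : ∀ l, ∃ l', ∀ p, G.Inc (g⁻¹ p) l' ↔ G.Inc p l) : ∃ f : G.Aut, f.1.1 = g := by
  choose a ha using hg
  choose b hb using hg'
  refine ⟨⟨(g, ⟨a, b, fun l => hext _ _ fun p => ?_, fun l => hext _ _ fun p => ?_⟩),
    fun p l => ha l p⟩, rfl⟩
  · simpa using (hb (a l) (g p)).trans (ha l p)
  · simpa using (ha (b l) (g⁻¹ p)).trans (hb l p)

/-- If a line is determined by its points, an automorphism is determined by its action on the
points. -/
theorem aut_ext (hext : ∀ l l' : G.Line, (∀ p, G.Inc p l ↔ G.Inc p l') → l = l') {f g : G.Aut}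
    (h : f.1.1 = g.1.1) : f = g := by
  refine Subtype.ext (Prod.ext h (Equiv.ext fun l => hext _ _ fun p => ?_))
  have h1 := f.2 (f.1.1⁻¹ p) l
  have h2 := g.2 (f.1.1⁻¹ p) l
  rw [← h] at h2
  rw [← Equiv.Perm.mul_apply, mul_inv_cancel, Equiv.Perm.one_apply] at h1 h2
  exact h1.trans h2.symm

end PointLineGeometry

section Pole

variable {F V : Type*} [Field F] [AddCommGroup V] [Module F V]

/-- The space is the orthogonal sum of `F e₀`, on which the symmetric form `ξ` is anisotropic, and
of `W`, on which it is nondegenerate and alternating. -/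
structure IsAnisotropicPole (ξ : LinearMap.BilinForm F V) (W : Submodule F V) (e₀ : V) :
    Prop where
  symm : ∀ u v, ξ u v = ξ v u
  self_ne_zero : ξ e₀ e₀ ≠ 0
  ortho : ∀ w ∈ W, ξ e₀ w = 0
  alt : ∀ w ∈ W, ξ w w = 0
  nondeg : ∀ u : W, (∀ v : W, ξ.restrict W u v = 0) → u = 0
  exists_eq_smul_add : ∀ v, ∃ (c : F) (w : W), v = c • e₀ + (w : V)

theorem span_singleton_mem_regularSubspaces_iff {ξ : LinearMap.BilinForm F V} {v : V} :
    Submodule.span F {v} ∈ regularSubspaces ξ 1 ↔ ξ v v ≠ 0 := by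
  constructor
  · rintro ⟨h1, h2⟩ h
    have hv : v ∈ radical ξ (Submodule.span F {v}) := by
      refine ⟨Submodule.mem_span_singleton_self v, fun n hn => ?_⟩
      obtain ⟨c, rfl⟩ := Submodule.mem_span_singleton.1 hn
      rw [map_smul, LinearMap.smul_apply, h, smul_zero]
    rw [h2, Submodule.mem_bot] at hv
    exact one_ne_zero (h1.symm.trans (by rw [hv, Submodule.span_zero_singleton, finrank_bot]))
  · intro h
    refine ⟨finrank_span_singleton fun h0 => h (by simp [h0]), (Submodule.eq_bot_iff _).2 ?_⟩
    rintro x ⟨hx, hx'⟩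
    obtain ⟨c, rfl⟩ := Submodule.mem_span_singleton.1 hx
    have := hx' v (Submodule.mem_span_singleton_self v)
    simp only [map_smul, smul_eq_mul, mul_eq_zero, h, or_false] at this
    simp [this]

namespace IsAnisotropicPole

variable {ξ : LinearMap.BilinForm F V} {W : Submodule F V} {e₀ : V}

theorem ortho_right (h : IsAnisotropicPole ξ W e₀) {w : V} (hw : w ∈ W) : ξ w e₀ = 0 := by
  rw [h.symm, h.ortho w hw]

theorem eq_zero_of_smul_mem (h : IsAnisotropicPole ξ W e₀) {c : F} (hc : c • e₀ ∈ W) :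
    c = 0 := by
  have := h.ortho _ hc
  simpa [h.self_ne_zero] using this

theorem apply_add_add (h : IsAnisotropicPole ξ W e₀) (u v : W) :
    ξ (e₀ + u) (e₀ + v) = ξ e₀ e₀ + ξ u v := by
  simp [h.ortho _ v.2, h.ortho_right u.2]

theorem affinePoint_mem (h : IsAnisotropicPole ξ W e₀) (w : W) :
    affinePoint e₀ w ∈ regularSubspaces ξ 1 := by
  rw [affinePoint, span_singleton_mem_regularSubspaces_iff, h.apply_add_add, h.alt _ w.2, add_zero]
  exact h.self_ne_zero

theorem eq_of_add_mem_span_singleton (h : IsAnisotropicPole ξ W e₀) {u v : W}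
    (huv : e₀ + (u : V) ∈ Submodule.span F {e₀ + (v : V)}) : u = v := by
  obtain ⟨c, hc⟩ := Submodule.mem_span_singleton.1 huv
  have hc1 : c - 1 = 0 := by
    refine h.eq_zero_of_smul_mem ?_
    have : (c - 1) • e₀ = ((u - c • v : W) : V) := by
      push_cast
      linear_combination (norm := module) hc
    rw [this]
    exact Subtype.coe_prop _
  rw [sub_eq_zero.1 hc1, one_smul] at hc
  exact Subtype.ext (add_left_cancel hc.symm)

theorem affinePoint_injective (h : IsAnisotropicPole ξ W e₀) :
    Function.Injective (affinePoint (F := F) (W := W) e₀) := fun u v huv =>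
  h.eq_of_add_mem_span_singleton (by
    rw [affinePoint, affinePoint] at huv
    rw [← huv]
    exact Submodule.mem_span_singleton_self _)

theorem exists_affinePoint_eq (h : IsAnisotropicPole ξ W e₀) {U : Submodule F V}
    (hU : U ∈ regularSubspaces ξ 1) : ∃ w : W, affinePoint e₀ w = U := by
  obtain ⟨v, -, hv⟩ := finrank_eq_one_iff'.1 hU.1
  have hUv : U = Submodule.span F {(v : V)} := by
    ext x
    rw [Submodule.mem_span_singleton]
    constructor
    · intro hx
      obtain ⟨c, hc⟩ := hv ⟨x, hx⟩
      exact ⟨c, congrArg Subtype.val hc⟩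
    · rintro ⟨c, rfl⟩
      exact U.smul_mem c v.2
  obtain ⟨c, w, hcw⟩ := h.exists_eq_smul_add v
  rw [hUv, span_singleton_mem_regularSubspaces_iff] at hU
  have hc : c ≠ 0 := by
    rintro rfl
    rw [zero_smul, zero_add] at hcw
    exact hU (h.alt _ (hcw ▸ w.2))
  refine ⟨c⁻¹ • w, ?_⟩
  rw [hUv, affinePoint, hcw, ← Submodule.span_singleton_smul_eq (IsUnit.mk0 c hc)]
  simp [hc]

theorem bijOn_affinePoint (h : IsAnisotropicPole ξ W e₀) :
    Set.BijOn (affinePoint (W := W) e₀) Set.univ (regularSubspaces ξ 1) :=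
  ⟨fun w _ => h.affinePoint_mem w, h.affinePoint_injective.injOn, fun _ hU => by
    simpa using h.exists_affinePoint_eq hU⟩

theorem affinePoint_le_span_pair_iff (h : IsAnisotropicPole ξ W e₀) {p d w : W} :
    affinePoint e₀ w ≤ Submodule.span F {e₀ + (p : V), (d : V)} ↔ ∃ t : F, w = p + t • d := by
  rw [affinePoint, Submodule.span_singleton_le_iff_mem, Submodule.mem_span_pair]
  constructor
  · rintro ⟨a, b, hab⟩
    have ha : a - 1 = 0 := by
      refine h.eq_zero_of_smul_mem ?_
      have : (a - 1) • e₀ = ((w - a • p - b • d : W) : V) := by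
        push_cast
        linear_combination (norm := module) hab
      rw [this]
      exact Subtype.coe_prop _
    rw [sub_eq_zero.1 ha, one_smul, add_assoc] at hab
    exact ⟨b, Subtype.ext (by simpa using (add_left_cancel hab).symm)⟩
  · rintro ⟨t, rfl⟩
    exact ⟨1, t, by simp [add_assoc]⟩

theorem linearIndependent_pair (h : IsAnisotropicPole ξ W e₀) {p d : W} (hd : d ≠ 0) :
    LinearIndependent F ![e₀ + (p : V), (d : V)] := by
  rw [LinearIndependent.pair_iff]
  intro a b hab
  have ha : a = 0 := by
    refine h.eq_zero_of_smul_mem ?_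
    have : a • e₀ = ((-(a • p) - b • d : W) : V) := by
      push_cast
      linear_combination (norm := module) hab
    rw [this]
    exact Subtype.coe_prop _
  subst ha
  refine ⟨rfl, ?_⟩
  simpa [hd] using hab

theorem finrank_span_pair (h : IsAnisotropicPole ξ W e₀) {p d : W} (hd : d ≠ 0) :
    finrank F (Submodule.span F {e₀ + (p : V), (d : V)}) = 2 := by
  have := finrank_span_eq_card (h.linearIndependent_pair (p := p) hd)
  rwa [Matrix.range_cons_cons_empty, Fintype.card_fin] at this

theorem span_pair_mem_regularSubspaces (h : IsAnisotropicPole ξ W e₀) {p d : W}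
    (hpd : ξ p d ≠ 0) :
    Submodule.span F {e₀ + (p : V), (d : V)} ∈ regularSubspaces ξ 2 := by
  refine ⟨h.finrank_span_pair (by rintro rfl; simp at hpd), (Submodule.eq_bot_iff _).2 ?_⟩
  rintro x ⟨hx, hx'⟩
  obtain ⟨a, b, rfl⟩ := Submodule.mem_span_pair.1 hx
  have h1 := hx' d (Submodule.subset_span (by simp))
  have h2 := hx' (e₀ + p) (Submodule.subset_span (by simp))
  have hdp : ξ d p ≠ 0 := by rwa [h.symm]
  simp only [map_add, map_smul, h.alt _ d.2,
    h.ortho_right d.2, smul_eq_mul, zero_add, mul_zero, add_zero, mul_eq_zero, hdp,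
    or_false] at h1
  subst h1
  simp only [map_add, map_smul, LinearMap.add_apply, smul_eq_mul,
    zero_mul, zero_add, h.ortho _ d.2, mul_eq_zero, hpd, or_false] at h2
  simp [h2]

theorem exists_eq_span_pair (h : IsAnisotropicPole ξ W e₀) {L : Submodule F V}
    (hL : L ∈ regularSubspaces ξ 2) {p : W} (hp : affinePoint e₀ p ≤ L) :
    ∃ d : W, ξ p d ≠ 0 ∧ L = Submodule.span F {e₀ + (p : V), (d : V)} := by
  have hpL : e₀ + (p : V) ∈ L := by
    rwa [affinePoint, Submodule.span_singleton_le_iff_mem] at hp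
  obtain ⟨v, hvL, hv⟩ : ∃ v ∈ L, v ∉ affinePoint e₀ p := by
    by_contra! hle
    have := (h.affinePoint_mem p).1
    rw [le_antisymm hp hle, hL.1] at this
    norm_num at this
  obtain ⟨c, w, rfl⟩ := h.exists_eq_smul_add v
  have hd : w - c • p ≠ 0 := by
    intro h0
    rw [sub_eq_zero.1 h0] at hv
    exact hv (Submodule.mem_span_singleton.2 ⟨c, by simp⟩)
  have hdL : ((w - c • p : W) : V) ∈ L := by
    have : ((w - c • p : W) : V) = (c • e₀ + w) - c • (e₀ + (p : V)) := by
      push_cast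
      module
    rw [this]
    exact L.sub_mem hvL (L.smul_mem c hpL)
  have hfin : FiniteDimensional F L := FiniteDimensional.of_finrank_pos (by rw [hL.1]; norm_num)
  have hspan : Submodule.span F {e₀ + (p : V), ((w - c • p : W) : V)} = L := by
    refine Submodule.eq_of_le_of_finrank_eq ?_ (by rw [h.finrank_span_pair hd, hL.1])
    rw [Submodule.span_le]
    rintro x (rfl | rfl)
    exacts [hpL, hdL]
  refine ⟨w - c • p, fun h0 => hd ?_, hspan.symm⟩
  have hrad : ((w - c • p : W) : V) ∈ radical ξ L := by
    refine ⟨hdL, fun n hn => ?_⟩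
    rw [← hspan] at hn
    obtain ⟨a, b, rfl⟩ := Submodule.mem_span_pair.1 hn
    simp only [map_add, map_smul, LinearMap.add_apply, LinearMap.smul_apply, h0,
      h.alt _ (Subtype.coe_prop (w - c • p)), h.ortho _ (Subtype.coe_prop (w - c • p)),
      smul_zero, add_zero]
  rw [hL.2, Submodule.mem_bot] at hrad
  exact_mod_cast hrad

theorem finrank_sup_le_two_iff_collinear [FiniteDimensional F V] (h : IsAnisotropicPole ξ W e₀)
    (u v w : W) : Collinear F {u, v, w} ↔
      finrank F ↥(affinePoint e₀ u ⊔ affinePoint e₀ v ⊔ affinePoint e₀ w) ≤ 2 := by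
  have hspan : vectorSpan F ({u, v, w} : Set W) = Submodule.span F {v - u, w - u} := by
    rw [vectorSpan_eq_span_vsub_set_right F (p := u) (by simp)]
    simp [Set.image_insert_eq]
  have hsup : affinePoint e₀ u ⊔ affinePoint e₀ v ⊔ affinePoint e₀ w =
      affinePoint e₀ u ⊔ (vectorSpan F ({u, v, w} : Set W)).map W.subtype := by
    have hu : e₀ + (u : V) ∈ affinePoint (F := F) e₀ u := Submodule.mem_span_singleton_self _
    rw [hspan, Submodule.map_span, Set.image_pair]
    refine le_antisymm (sup_le (sup_le le_sup_left ?_) ?_) (sup_le (le_sup_left.trans le_sup_left) ?_)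
    · rw [affinePoint, Submodule.span_singleton_le_iff_mem, ← add_sub_cancel (e₀ + (u : V)) (e₀ + v)]
      refine add_mem (Submodule.mem_sup_left hu) (Submodule.mem_sup_right ?_)
      exact Submodule.subset_span (by simp)
    · rw [affinePoint, Submodule.span_singleton_le_iff_mem, ← add_sub_cancel (e₀ + (u : V)) (e₀ + w)]
      refine add_mem (Submodule.mem_sup_left hu) (Submodule.mem_sup_right ?_)
      exact Submodule.subset_span (by simp)
    · have hu' := Submodule.mem_sup_left (T := affinePoint (F := F) e₀ w)
        (Submodule.mem_sup_left (T := affinePoint (F := F) e₀ v) hu)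
      rw [Submodule.span_le]
      rintro x (rfl | rfl)
      · have : W.subtype (v - u) = (e₀ + (v : V)) - (e₀ + u) := by simp
        rw [this]
        exact sub_mem (Submodule.mem_sup_left (Submodule.mem_sup_right
          (Submodule.mem_span_singleton_self _))) hu'
      · have : W.subtype (w - u) = (e₀ + (w : V)) - (e₀ + u) := by simp
        rw [this]
        exact sub_mem (Submodule.mem_sup_right (Submodule.mem_span_singleton_self _)) hu'
  have hinf : affinePoint e₀ u ⊓ (vectorSpan F ({u, v, w} : Set W)).map W.subtype = ⊥ := by
    rw [Submodule.eq_bot_iff]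
    rintro x ⟨hx, y, -, rfl⟩
    obtain ⟨c, hc⟩ := Submodule.mem_span_singleton.1 hx
    have hc0 : c = 0 := by
      refine h.eq_zero_of_smul_mem ?_
      have : c • e₀ = ((y - c • u : W) : V) := by
        push_cast
        rw [Submodule.subtype_apply] at hc
        linear_combination (norm := module) hc
      rw [this]
      exact Subtype.coe_prop _
    rw [← hc, hc0, zero_smul]
  have hrank := Submodule.finrank_sup_add_finrank_inf_eq (affinePoint e₀ u)
    ((vectorSpan F ({u, v, w} : Set W)).map W.subtype)
  rw [hinf, finrank_bot, (h.affinePoint_mem u).1, Submodule.finrank_map_subtype_eq] at hrank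
  rw [hsup, collinear_iff_finrank_le_one]
  omega

end IsAnisotropicPole

end Pole

section Coordinates

variable {F V : Type*} [Field F] [AddCommGroup V] [Module F V]

/-- The two-dimensional subspace of `V` which a line of the regular geometry is. -/
def regularGeometry.lineSubspace {ξ : LinearMap.BilinForm F V}
    (l : (regularGeometry ξ).Line) : Submodule F V :=
  Subtype.val (p := fun U => U ∈ regularSubspaces ξ 2) (Subtype.val l)

namespace regularGeometry

variable {ξ : LinearMap.BilinForm F V}

theorem inc_iff {p : (regularGeometry ξ).Point} {l : (regularGeometry ξ).Line} :
    (regularGeometry ξ).Inc p l ↔ pointSubspace p ≤ lineSubspace l := Iff.rfl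

theorem pointSubspace_injective :
    Function.Injective (pointSubspace : (regularGeometry ξ).Point → Submodule F V) :=
  fun _ _ h => Subtype.ext (Subtype.ext h)

theorem lineSubspace_injective :
    Function.Injective (lineSubspace : (regularGeometry ξ).Line → Submodule F V) :=
  fun _ _ h => Subtype.ext (Subtype.ext h)

theorem exists_pointSubspace_eq_iff {U : Submodule F V} :
    (∃ p : (regularGeometry ξ).Point, pointSubspace p = U) ↔
      U ∈ regularSubspaces ξ 1 ∧ ∃ L ∈ regularSubspaces ξ 2, U ≤ L := by
  constructor
  · rintro ⟨⟨⟨U, hU⟩, ⟨L, hL⟩, hUL⟩, rfl⟩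
    exact ⟨hU, L, hL, hUL⟩
  · rintro ⟨hU, L, hL, hUL⟩
    exact ⟨⟨⟨U, hU⟩, ⟨L, hL⟩, hUL⟩, rfl⟩

theorem exists_lineSubspace_eq_iff {L : Submodule F V} :
    (∃ l : (regularGeometry ξ).Line, lineSubspace l = L) ↔
      L ∈ regularSubspaces ξ 2 ∧ ∃ U ∈ regularSubspaces ξ 1, U ≤ L := by
  constructor
  · rintro ⟨⟨⟨L, hL⟩, ⟨U, hU⟩, hUL⟩, rfl⟩
    exact ⟨hL, U, hU, hUL⟩
  · rintro ⟨hL, U, hU, hUL⟩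
    exact ⟨⟨⟨L, hL⟩, ⟨U, hU⟩, hUL⟩, rfl⟩

end regularGeometry

open regularGeometry

namespace IsAnisotropicPole

variable {ξ : LinearMap.BilinForm F V} {W : Submodule F V} {e₀ : V}

theorem exists_pointSubspace_eq_affinePoint_iff (h : IsAnisotropicPole ξ W e₀) (w : W) :
    (∃ p : (regularGeometry ξ).Point, pointSubspace p = affinePoint e₀ w) ↔ w ≠ 0 := by
  rw [exists_pointSubspace_eq_iff]
  constructor
  · rintro ⟨-, L, hL, hwL⟩ rfl
    obtain ⟨d, hd, -⟩ := h.exists_eq_span_pair hL hwL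
    simp at hd
  · intro hw
    obtain ⟨d, hd⟩ : ∃ d : W, ξ w d ≠ 0 := by
      by_contra! h0
      exact hw (h.nondeg w h0)
    exact ⟨h.affinePoint_mem w, _, h.span_pair_mem_regularSubspaces hd,
      h.affinePoint_le_span_pair_iff.2 ⟨0, by simp⟩⟩

/-- The nonzero vectors of `W` as coordinates of the points of the regular geometry. -/
noncomputable def pointEquiv (h : IsAnisotropicPole ξ W e₀) :
    {w : W // w ≠ 0} ≃ (regularGeometry ξ).Point :=
  Equiv.ofBijective
    (fun w => ((h.exists_pointSubspace_eq_affinePoint_iff w.1).2 w.2).choose) <| by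
      have hc := fun w : {w : W // w ≠ 0} =>
        ((h.exists_pointSubspace_eq_affinePoint_iff w.1).2 w.2).choose_spec
      constructor
      · intro u v huv
        have := congrArg pointSubspace huv
        simp only [hc] at this
        exact Subtype.ext (h.affinePoint_injective this)
      · intro p
        obtain ⟨w, hw⟩ := h.exists_affinePoint_eq (exists_pointSubspace_eq_iff.1 ⟨p, rfl⟩).1
        have hw0 : w ≠ 0 := (h.exists_pointSubspace_eq_affinePoint_iff w).1 ⟨p, hw.symm⟩
        exact ⟨⟨w, hw0⟩, pointSubspace_injective ((hc ⟨w, hw0⟩).trans hw)⟩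

theorem pointSubspace_pointEquiv (h : IsAnisotropicPole ξ W e₀) (w : {w : W // w ≠ 0}) :
    pointSubspace (h.pointEquiv w) = affinePoint e₀ w.1 :=
  ((h.exists_pointSubspace_eq_affinePoint_iff w.1).2 w.2).choose_spec

theorem exists_lineSubspace_eq_span_pair (h : IsAnisotropicPole ξ W e₀)
    (l : (regularGeometry ξ).Line) :
    ∃ p d : W, ξ p d ≠ 0 ∧ lineSubspace l = Submodule.span F {e₀ + (p : V), (d : V)} := by
  obtain ⟨hL, U, hU, hUL⟩ := exists_lineSubspace_eq_iff.1 ⟨l, rfl⟩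
  obtain ⟨p, rfl⟩ := h.exists_affinePoint_eq hU
  exact ⟨p, h.exists_eq_span_pair hL hUL⟩

theorem exists_line (h : IsAnisotropicPole ξ W e₀) {p d : W} (hpd : ξ p d ≠ 0) :
    ∃ l : (regularGeometry ξ).Line, ∀ w : {w : W // w ≠ 0},
      (regularGeometry ξ).Inc (h.pointEquiv w) l ↔ ∃ t : F, w.1 = p + t • d := by
  obtain ⟨l, hl⟩ := exists_lineSubspace_eq_iff.2 ⟨h.span_pair_mem_regularSubspaces hpd,
    _, h.affinePoint_mem p, h.affinePoint_le_span_pair_iff.2 ⟨0, by simp⟩⟩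
  refine ⟨l, fun w => ?_⟩
  rw [inc_iff, hl, h.pointSubspace_pointEquiv, h.affinePoint_le_span_pair_iff]

theorem exists_inc_iff (h : IsAnisotropicPole ξ W e₀) (l : (regularGeometry ξ).Line) :
    ∃ p d : W, ξ p d ≠ 0 ∧ ∀ w : {w : W // w ≠ 0},
      (regularGeometry ξ).Inc (h.pointEquiv w) l ↔ ∃ t : F, w.1 = p + t • d := by
  obtain ⟨p, d, hpd, hl⟩ := h.exists_lineSubspace_eq_span_pair l
  refine ⟨p, d, hpd, fun w => ?_⟩
  rw [inc_iff, hl, h.pointSubspace_pointEquiv, h.affinePoint_le_span_pair_iff]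

theorem line_point_ne_zero (h : IsAnisotropicPole ξ W e₀) {p d : W} (hpd : ξ p d ≠ 0) (t : F) :
    p + t • d ≠ 0 := by
  intro h0
  have := congrArg (fun x : W => ξ x d) h0
  simp [h.alt _ d.2, hpd] at this

theorem line_ext (h : IsAnisotropicPole ξ W e₀) (l l' : (regularGeometry ξ).Line)
    (hl : ∀ p, (regularGeometry ξ).Inc p l ↔ (regularGeometry ξ).Inc p l') : l = l' := by
  obtain ⟨p, d, hpd, hld⟩ := h.exists_lineSubspace_eq_span_pair l
  have hle : ∀ t : F, e₀ + ((p + t • d : W) : V) ∈ lineSubspace l' := by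
    intro t
    have h1 := hl (h.pointEquiv ⟨p + t • d, h.line_point_ne_zero hpd t⟩)
    rw [inc_iff, inc_iff, h.pointSubspace_pointEquiv, hld, h.affinePoint_le_span_pair_iff,
      affinePoint, Submodule.span_singleton_le_iff_mem] at h1
    exact h1.1 ⟨t, rfl⟩
  have hL := (exists_lineSubspace_eq_iff.1 ⟨l, rfl⟩).1.1
  have hL' := (exists_lineSubspace_eq_iff.1 ⟨l', rfl⟩).1.1
  have : FiniteDimensional F (lineSubspace l') :=
    FiniteDimensional.of_finrank_pos (by rw [hL']; norm_num)
  refine lineSubspace_injective (Submodule.eq_of_le_of_finrank_eq ?_ (hL.trans hL'.symm))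
  rw [hld, Submodule.span_le]
  rintro x (rfl | rfl)
  · simpa using hle 0
  · have := sub_mem (hle 1) (hle 0)
    simpa using this

open Classical in
/-- The action of the automorphism group in coordinates; the origin is fixed. -/
noncomputable def coordinateAction (h : IsAnisotropicPole ξ W e₀) :
    (regularGeometry ξ).Aut →* Equiv.Perm W :=
  (Equiv.Perm.ofSubtype (p := fun w : W => w ≠ 0)).comp
    (h.pointEquiv.symm.permCongrHom.toMonoidHom.comp
      ((MonoidHom.fst _ _).comp (regularGeometry ξ).Aut.subtype))

theorem coordinateAction_zero (h : IsAnisotropicPole ξ W e₀) (f : (regularGeometry ξ).Aut) :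
    h.coordinateAction f 0 = 0 := by
  classical
  exact Equiv.Perm.ofSubtype_apply_of_not_mem _ (by simp)

theorem coordinateAction_coe (h : IsAnisotropicPole ξ W e₀) (f : (regularGeometry ξ).Aut)
    (w : {w : W // w ≠ 0}) :
    h.coordinateAction f w = (h.pointEquiv.symm (f.1.1 (h.pointEquiv w))).1 := by
  classical
  exact Equiv.Perm.ofSubtype_apply_coe _ w

theorem coordinateAction_ne_zero (h : IsAnisotropicPole ξ W e₀) (f : (regularGeometry ξ).Aut)
    {w : W} (hw : w ≠ 0) : h.coordinateAction f w ≠ 0 := fun h0 =>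
  hw ((h.coordinateAction f).injective (h0.trans (h.coordinateAction_zero f).symm))

theorem pointEquiv_coordinateAction (h : IsAnisotropicPole ξ W e₀) (f : (regularGeometry ξ).Aut)
    (w : {w : W // w ≠ 0}) :
    h.pointEquiv ⟨h.coordinateAction f w, h.coordinateAction_ne_zero f w.2⟩ =
      f.1.1 (h.pointEquiv w) := by
  rw [← Equiv.eq_symm_apply]
  exact Subtype.ext (h.coordinateAction_coe f w)

theorem pointSubspace_apply (h : IsAnisotropicPole ξ W e₀) (f : (regularGeometry ξ).Aut)
    {p : (regularGeometry ξ).Point} {w : W} (hp : pointSubspace p = affinePoint e₀ w) :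
    pointSubspace (f.1.1 p) = affinePoint e₀ (h.coordinateAction f w) := by
  have hw : w ≠ 0 := (h.exists_pointSubspace_eq_affinePoint_iff w).1 ⟨p, hp⟩
  have : p = h.pointEquiv ⟨w, hw⟩ :=
    pointSubspace_injective (hp.trans (h.pointSubspace_pointEquiv ⟨w, hw⟩).symm)
  rw [this, ← h.pointEquiv_coordinateAction, h.pointSubspace_pointEquiv]

theorem coordinateAction_injective (h : IsAnisotropicPole ξ W e₀) :
    Function.Injective h.coordinateAction := by
  intro f g hfg
  refine PointLineGeometry.aut_ext h.line_ext (Equiv.ext fun p => ?_)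
  obtain ⟨w, rfl⟩ := h.pointEquiv.surjective p
  rw [← h.pointEquiv_coordinateAction, ← h.pointEquiv_coordinateAction]
  simp only [hfg]

theorem mapsHyperbolicLines_coordinateAction (h : IsAnisotropicPole ξ W e₀)
    (f : (regularGeometry ξ).Aut) :
    MapsHyperbolicLines (ξ.restrict W) (h.coordinateAction f) := by
  intro p d hpd
  obtain ⟨l, hl⟩ := h.exists_line (p := p) (d := d) hpd
  obtain ⟨p', d', hpd', hl'⟩ := h.exists_inc_iff (f.1.2 l)
  refine ⟨p', d', hpd', fun w => ?_⟩
  rcases eq_or_ne w 0 with rfl | hw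
  · rw [h.coordinateAction_zero]
    exact iff_of_false (fun ⟨t, ht⟩ => h.line_point_ne_zero hpd' t ht.symm)
      (fun ⟨t, ht⟩ => h.line_point_ne_zero hpd t ht.symm)
  · have h1 := hl' ⟨h.coordinateAction f w, h.coordinateAction_ne_zero f hw⟩
    rw [h.pointEquiv_coordinateAction f ⟨w, hw⟩, f.2, hl] at h1
    exact h1.symm

theorem exists_line_map (h : IsAnisotropicPole ξ W e₀) {g : Equiv.Perm W}
    (hg : MapsHyperbolicLines (ξ.restrict W) g) {γ : Equiv.Perm (regularGeometry ξ).Point}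
    (hγ : ∀ w (hw : w ≠ 0) (hgw : g w ≠ 0),
      γ (h.pointEquiv ⟨w, hw⟩) = h.pointEquiv ⟨g w, hgw⟩) (hg0 : ∀ w, w ≠ 0 → g w ≠ 0)
    (l : (regularGeometry ξ).Line) :
    ∃ l', ∀ p, (regularGeometry ξ).Inc (γ p) l' ↔ (regularGeometry ξ).Inc p l := by
  obtain ⟨p, d, hpd, hl⟩ := h.exists_inc_iff l
  obtain ⟨p', d', hpd', hg⟩ := hg p d hpd
  obtain ⟨l', hl'⟩ := h.exists_line (p := p') (d := d') hpd'
  refine ⟨l', fun q => ?_⟩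
  obtain ⟨⟨w, hw⟩, rfl⟩ := h.pointEquiv.surjective q
  rw [hγ w hw (hg0 w hw), hl', hl, hg]

theorem exists_coordinateAction_eq (h : IsAnisotropicPole ξ W e₀) {g : Equiv.Perm W}
    (hg0 : g 0 = 0) (hg : MapsHyperbolicLines (ξ.restrict W) g)
    (hg' : MapsHyperbolicLines (ξ.restrict W) g⁻¹) : ∃ f, h.coordinateAction f = g := by
  have hne : ∀ w, g w ≠ 0 ↔ w ≠ 0 := fun w => by
    rw [Ne, ← hg0, g.injective.eq_iff, hg0]
  have hg0' : g⁻¹ 0 = 0 := by rw [Equiv.Perm.inv_eq_iff_eq, hg0]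
  have hne' : ∀ w, w ≠ 0 → g⁻¹ w ≠ 0 := fun w hw h0 =>
    hw (g⁻¹.injective (h0.trans hg0'.symm))
  set γ : Equiv.Perm (regularGeometry ξ).Point := h.pointEquiv.permCongr (g.subtypePerm hne)
    with hγdef
  have hγ : ∀ w (hw : w ≠ 0) (hgw : g w ≠ 0),
      γ (h.pointEquiv ⟨w, hw⟩) = h.pointEquiv ⟨g w, hgw⟩ := fun w hw hgw => by
    simp [hγdef, Equiv.permCongr_apply]
  have hγ' : ∀ w (hw : w ≠ 0) (hgw : g⁻¹ w ≠ 0),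
      γ⁻¹ (h.pointEquiv ⟨w, hw⟩) = h.pointEquiv ⟨g⁻¹ w, hgw⟩ := fun w hw hgw => by
    rw [Equiv.Perm.inv_eq_iff_eq, hγ _ _ (by simpa using hw)]
    simp
  obtain ⟨f, hf⟩ := PointLineGeometry.exists_mem_aut_of_maps_lines h.line_ext γ
    (h.exists_line_map hg hγ fun w => (hne w).2) (h.exists_line_map hg' hγ' hne')
  refine ⟨f, Equiv.ext fun w => ?_⟩
  rcases eq_or_ne w 0 with rfl | hw
  · rw [h.coordinateAction_zero, hg0]
  · have h1 := h.pointEquiv_coordinateAction f ⟨w, hw⟩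
    rw [hf, hγ w hw ((hne w).2 hw), h.pointEquiv.apply_eq_iff_eq] at h1
    exact congrArg Subtype.val h1

theorem range_coordinateAction [CharP F 2] (hF : 5 ≤ ENat.card F)
    (h : IsAnisotropicPole ξ W e₀) :
    h.coordinateAction.range = semilinearGroup F W ⊓ conjugacyStabilizer (ξ.restrict W) := by
  ext g
  rw [← mapsHyperbolicLines_iff (B := ξ.restrict W) hF (fun u => h.alt _ u.2) h.nondeg,
    MonoidHom.mem_range]
  constructor
  · rintro ⟨f, rfl⟩
    rw [← map_inv]
    exact ⟨h.coordinateAction_zero f, h.mapsHyperbolicLines_coordinateAction f,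
      h.mapsHyperbolicLines_coordinateAction f⁻¹⟩
  · rintro ⟨h0, h1, h2⟩
    exact h.exists_coordinateAction_eq h0 h1 h2

end IsAnisotropicPole

theorem isAnisotropicPole_of_isCoatom {ξ : LinearMap.BilinForm F V} (hsymm : ξ.IsSymm)
    (hnondeg : ξ.Nondegenerate) {W : Submodule F V} (hW : ∀ v, v ∈ W ↔ ξ v v = 0)
    (hWhyp : IsCoatom W) {e₀ : V} (hpole : Submodule.span F {e₀} = ξ.orthogonal W)
    (hb : e₀ ∉ W) : IsAnisotropicPole ξ W e₀ := by
  have hdec : ∀ v, ∃ (c : F) (w : W), v = c • e₀ + (w : V) := by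
    intro v
    have htop : Submodule.span F {e₀} ⊔ W = ⊤ := hWhyp.2 _ (lt_of_le_of_ne le_sup_right
      fun h => hb (h ▸ Submodule.mem_sup_left (Submodule.mem_span_singleton_self e₀)))
    have hv : v ∈ Submodule.span F {e₀} ⊔ W := htop ▸ Submodule.mem_top
    obtain ⟨x, hx, w, hw, rfl⟩ := Submodule.mem_sup.1 hv
    obtain ⟨c, rfl⟩ := Submodule.mem_span_singleton.1 hx
    exact ⟨c, ⟨w, hw⟩, rfl⟩
  have hs : ∀ u v, ξ u v = ξ v u := fun u v => hsymm.eq u v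
  have hortho : ∀ w ∈ W, ξ e₀ w = 0 := by
    intro w hw
    have he : e₀ ∈ ξ.orthogonal W := hpole ▸ Submodule.mem_span_singleton_self e₀
    rw [hs]
    exact he w hw
  refine ⟨hs, fun h => hb ((hW e₀).2 h), hortho, fun w hw => (hW w).1 hw, fun u hu => ?_, hdec⟩
  refine Subtype.ext (hnondeg.1 u fun v => ?_)
  obtain ⟨c, w, rfl⟩ := hdec v
  have := hu w
  simp only [LinearMap.BilinForm.restrict_apply, LinearMap.domRestrict_apply] at this
  rw [map_add, map_smul, hs, hortho _ u.2, smul_zero, zero_add, this]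

end Coordinates

theorem proposition3p22 {F V : Type*} [Field F] [CharP F 2] [PerfectField F]
    (hF : 5 ≤ ENat.card F)
    [AddCommGroup V] [Module F V] [FiniteDimensional F V]
    (ξ : LinearMap.BilinForm F V) (hsymm : ξ.IsSymm) (hnondeg : ξ.Nondegenerate)
    -- the selfconjugate points form a hyperplane, `W` is the corresponding vector subspace
    (W : Submodule F V) (hW : ∀ v, v ∈ W ↔ ξ v v = 0) (hWhyp : IsCoatom W)
    -- the pole `⟨e₀⟩` of the hyperplane does not lie on it
    (e₀ : V) (hpole : Submodule.span F {e₀} = ξ.orthogonal W) (hb : e₀ ∉ W) :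
    -- the regular points form the affine space over `W` with the pole at the origin
    Set.BijOn (affinePoint (W := W) e₀) Set.univ (regularSubspaces ξ 1) ∧
    (∀ u v w : W, Collinear F {u, v, w} ↔
      finrank F ↥(affinePoint e₀ u ⊔ affinePoint e₀ v ⊔ affinePoint e₀ w) ≤ 2) ∧
    -- the points of the regular geometry are the affine points distinct from the origin
    (∀ w : W, (∃ p : (regularGeometry ξ).Point,
      regularGeometry.pointSubspace p = affinePoint e₀ w) ↔ w ≠ 0) ∧
    -- in these coordinates the automorphisms are the semilinear bijections of `W` which
    -- preserve the conjugacy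
    ∃ Φ : (regularGeometry ξ).Aut ≃*
        ↥(semilinearGroup F W ⊓ conjugacyStabilizer (ξ.restrict W)),
      ∀ (f : (regularGeometry ξ).Aut) (p : (regularGeometry ξ).Point) (w : W),
        regularGeometry.pointSubspace p = affinePoint e₀ w →
        regularGeometry.pointSubspace (f.1.1 p) = affinePoint e₀ ((Φ f).1 w) := by
  have h := isAnisotropicPole_of_isCoatom hsymm hnondeg hW hWhyp hpole hb
  exact ⟨h.bijOn_affinePoint, h.finrank_sup_le_two_iff_collinear,
    h.exists_pointSubspace_eq_affinePoint_iff,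
    (MonoidHom.ofInjective h.coordinateAction_injective).trans
      (MulEquiv.subgroupCongr (h.range_coordinateAction hF)),
    fun f p w hp => h.pointSubspace_apply f hp⟩
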